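/- **Setting.** A radial multi-phase distribution grid has a substation (bus $0$) and a non-empty finite set $\mathcal M^+$ of other buses; it is a tree rooted at $0$, and $\mathrm{pa}(i)$ is the parent of bus $i\in\mathcal M^+$. The branch between $i$ and $\mathrm{pa}(i)$ has an admittance matrix $Y_i\in\mathbb C^{3\times 3}$ (phases may be coupled; shunts are neglected). Each bus $b$ carries phasors in a complex subspace $S_b\subseteq\mathbb C^3$ (all of $\mathbb C^3$ for a three-phase bus, the vectors vanishing on the missing phases for a one- or two-phase bus, the multiples of $(1,h^2,h)$ with $h=e^{2\pi \mathrm j/3}$ in exactly balanced operation), where $S_i\subseteq S_{\mathrm{pa}(i)}$, $Y_iS_{\mathrm{pa}(i)}\subseteq S_i$ and $Y_i$ is injective on $S_i$ (for three-phase buses: $Y_i$ is invertible). The voltage increments $\Delta V_b$ at the buses and the current injection increments $\Delta I_i$ at the buses $i\in\mathcal M^+$ are random vectors in $\mathbb C^3$ such that almost surely $\Delta V_0=0$ (fixed substation voltage), $\Delta V_i\in S_i$, and $$\Delta I_i=Y_i(\Delta V_i-\Delta V_{\mathrm{pa}(i)})+\sum_{k:\,\mathrm{pa}(k)=i}Y_k(\Delta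 V_i-\Delta V_k)\qquad(i\in\mathcal M^+).$$ Assume that the $\Delta I_i$, $i\in\mathcal M^+$, are mutually independent and that each is Gaussian (as a real random vector) with mean zero and with covariance that is nonsingular on $S_i$. Let $P$ be the joint law of $(\Delta V_i)_{i\in\mathcal M^+}$, with marginals $P_i$, and let $I(\Delta V_i;\Delta V_k)$ be the mutual information, i.e. the Kullback-Leibler divergence of the joint law of the pair from the product of its marginals; put $I(\Delta V_i;\Delta V_0)=0$. A *radial topology* is a parent map $\Theta:\mathcal M^+\to\mathcal M^+\cup\{0\}$ that describes a tree rooted at $0$. Its tree-structured law is $Q(\cdot;\Theta)=\prod_{i\in\mathcal M^+}P(\Delta V_i\mid\Delta V_{\Theta_i})$, where $P(\Delta V_i\mid\Delta V_0)=P(\Delta V_i)$; that is, $Q(\cdot;\Theta)$ has density $\prod_{i:\,\Theta_i\neq0}\frac{p(v_i,v_{\Theta_i})}{p(v_i)\,p(v_{\Theta_i})}$ with respect to $\prod_iP_i$. A radial topology is *best-fitted* if it minimizes $D(P\,\|\,Q(\cdot;\Theta))$ over all radial topologies. Its branches are the pairs $\{i,\Theta_i\}$ with $\Theta_i\ne0$.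 The *Chow-Liu algorithm* sorts all pairs of distinct buses of $\mathcal M^+$ by non-increasing mutual information, runs through them, chooses every pair that closes no cycle with those already chosen, and stops when $|\mathcal M^+|-1$ pairs have been chosen. **Theorem.** The mutual informations of distinct buses are finite, every $Q(\cdot;\Theta)$ is a probability law, and every $D(P\,\|\,Q(\cdot;\Theta))$ is finite. A map $\Theta$ is a best-fitted topology if and only if it maximizes $\sum_{i\in\mathcal M^+}I(\Delta V_i;\Delta V_{\Theta_i})$ over all radial topologies. A radial topology in which exactly one bus is fed directly by the substation is best-fitted if and only if its branches form a maximum weight spanning tree of $\mathcal M^+$ with the pairwise mutual informations as weights. The Chow-Liu algorithm, however ties in the sorting are broken, returns a maximum weight spanning tree of $\mathcal M^+$, and this is the best-fitted topology: for every bus $r\in\mathcal M^+$ the tree is the set of branches of some radial topology in which $r$ is fed by the substation, and every radial topology with this set of branches is best-fitted. If the grid itself satisfies $P=Q(\cdot;\mathrm{pa})$, then every such topology $\Theta$ satisfies $Q(\cdot;\Theta)=P$. If in the grid exactly one bus is fed directly by the substation, and every best-fitted topology with this property has the same branches as the grid, then the algorithm returns exactly the branches of the grid. -/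

import Mathlib

open MeasureTheory ProbabilityTheory InformationTheory
open scoped ENNReal

namespace ChowLiuGrid

/-- Three-phase complex phasors; the three coordinates are the phases `a`, `b`, `c`. -/
abbrev Phasor : Type := Fin 3 → ℂ

/-! Throughout, `ι` is the set of non-slack buses and `Option ι` is the set of all buses, the
substation (slack bus, root of the network) being `none`. -/

/-- A parent map is radial if following parents from any bus leads to the substation in finitely
many steps, i.e. if it describes a tree on all buses that is rooted at the substation. -/
def IsRadial {ι : Type*} (Θ : ι → Option ι) : Prop :=
  ∀ i : ι, ∃ n : ℕ, (fun b : Option ι => b.bind Θ)^[n] (some i) = none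

/-- Exactly one bus is fed directly by the substation. -/
def SingleFeeder {ι : Type*} (Θ : ι → Option ι) : Prop := ∃! i : ι, Θ i = none

/-- The branches of a parent map between non-slack buses, as unordered pairs of buses. -/
noncomputable def branches {ι : Type*} [Fintype ι] (Θ : ι → Option ι) : Finset (Sym2 ι) :=
  open Classical in
  Finset.univ.filter (fun e => ∃ i k : ι, Θ i = some k ∧ e = s(i, k))

/-- A radial multi-phase distribution grid, shunt elements neglected.

The branch that joins bus `i` to its parent has the `3 × 3` phase admittance matrix
`admittance i`; phases may be coupled. Distinct buses that are not joined have no admittance.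

`carrier b` is the space of phasors that bus `b` can carry: all of `ℂ³` at a three-phase bus, the
phasors that vanish on the missing phases at a one- or two-phase bus, and the line of multiples of
`(1, h², h)`, `h = exp (2πj/3)`, if the operation is exactly balanced. A bus carries no more than
its parent, and the admittance of a branch is invertible on the phasors of the bus it feeds (for a
three-phase bus: it is an invertible matrix). -/
structure RadialGrid (ι : Type*) where
  /-- the parent of each non-slack bus -/
  parent : ι → Option ι
  /-- the grid is a tree rooted at the substation -/
  radial : IsRadial parent
  /-- the phasors each bus can carry -/
  carrier : Option ι → Submodule ℂ Phasor
  /-- the admittance matrix of the branch from `parent i` to `i` -/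
  admittance : ι → Matrix (Fin 3) (Fin 3) ℂ
  carrier_le : ∀ i, carrier (some i) ≤ carrier (parent i)
  admittance_mem : ∀ i, ∀ v ∈ carrier (parent i), (admittance i).mulVec v ∈ carrier (some i)
  admittance_inj : ∀ i, ∀ v ∈ carrier (some i), (admittance i).mulVec v = 0 → v = 0

/-- The current injected at bus `i` when the bus voltages are `v` (nodal admittance equation):
the sum over all branches at `i` of the branch admittance times the voltage difference. -/
noncomputable def RadialGrid.injection {ι : Type*} [Fintype ι] (N : RadialGrid ι)
    (v : Option ι → Phasor) (i : ι) : Phasor :=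
  open Classical in
  (N.admittance i).mulVec (v (some i) - v (N.parent i)) +
    ∑ k ∈ Finset.univ.filter (fun k => N.parent k = some i),
      (N.admittance k).mulVec (v (some i) - v (some k))

section Information

/-- The mutual information of the coordinates `i` and `k` under the joint law `P`: the
Kullback-Leibler divergence of their joint law from the product of their marginal laws. -/
noncomputable def mutualInfo {ι : Type*} (P : Measure (ι → Phasor)) (i k : ι) : ℝ≥0∞ :=
  klDiv (P.map (fun v => (v i, v k)))
    ((P.map (fun v => v i)).prod (P.map (fun v => v k)))

theorem mutualInfo_le_swap {ι : Type*} (P : Measure (ι → Phasor)) [IsFiniteMeasure P] (i k : ι) :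
    mutualInfo P i k ≤ mutualInfo P k i := by
  have h := klDiv_map_le (P.map (fun v => (v k, v i)))
    ((P.map (fun v => v k)).prod (P.map (fun v => v i)))
    (g := (Prod.swap : Phasor × Phasor → Phasor × Phasor)) measurable_swap
  rw [Measure.prod_swap, Measure.map_map measurable_swap (by fun_prop)] at h
  exact h

theorem mutualInfo_comm {ι : Type*} (P : Measure (ι → Phasor)) [IsFiniteMeasure P] (i k : ι) :
    mutualInfo P i k = mutualInfo P k i :=
  le_antisymm (mutualInfo_le_swap P i k) (mutualInfo_le_swap P k i)

/-- The mutual information as a weight of unordered pairs of buses. -/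
noncomputable def pairInfo {ι : Type*} (P : Measure (ι → Phasor)) [IsFiniteMeasure P] :
    Sym2 ι → ℝ≥0∞ :=
  Sym2.lift ⟨mutualInfo P, mutualInfo_comm P⟩

/-- The density of the conditional law `P(v_i | v_b)` of coordinate `i` given that of its
candidate parent `b`, relative to the marginal law `P(v_i)`, i.e. `p(v_i, v_k) / (p(v_i) p(v_k))`
for `b = k` a non-slack bus. The increment at the substation is a constant, so that
`P(v_i | v_0) = P(v_i)` and the density is `1`. -/
noncomputable def condDensity {ι : Type*} (P : Measure (ι → Phasor)) (i : ι) :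
    Option ι → (ι → Phasor) → ℝ≥0∞
  | none, _ => 1
  | some k, v =>
      (P.map (fun u => (u i, u k))).rnDeriv
        ((P.map (fun u => u i)).prod (P.map (fun u => u k))) (v i, v k)

/-- The tree-structured law `Q(· ; Θ) = ∏ i, P(v_i | v_{Θ i})` of a candidate topology `Θ`, given
by its density relative to the product of the marginal laws `P(v_i)`. -/
noncomputable def treeModel {ι : Type*} [Fintype ι] (P : Measure (ι → Phasor))
    (Θ : ι → Option ι) : Measure (ι → Phasor) :=
  (Measure.pi (fun i => P.map (fun v => v i))).withDensity
    (fun v => ∏ i, condDensity P i (Θ i) v)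

/-- `Θ` is a best-fitted topology: among all radial topologies it minimizes the Kullback-Leibler
divergence of the tree-structured law from the true joint law. -/
def IsBestFitted {ι : Type*} [Fintype ι] (P : Measure (ι → Phasor)) (Θ : ι → Option ι) : Prop :=
  IsRadial Θ ∧ ∀ Θ' : ι → Option ι, IsRadial Θ' →
    klDiv P (treeModel P Θ) ≤ klDiv P (treeModel P Θ')

/-- The mutual information of bus `i` and its candidate parent; it is zero for the substation,
whose increment is a constant. -/
noncomputable def parentInfo {ι : Type*} (P : Measure (ι → Phasor)) (i : ι) : Option ι → ℝ≥0∞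
  | none => 0
  | some k => mutualInfo P i k

/-- `Θ` maximizes the sum of the mutual informations of the buses with their parents among all
radial topologies. -/
def MaximizesInfo {ι : Type*} [Fintype ι] (P : Measure (ι → Phasor)) (Θ : ι → Option ι) : Prop :=
  IsRadial Θ ∧ ∀ Θ' : ι → Option ι, IsRadial Θ' →
    ∑ i, parentInfo P i (Θ' i) ≤ ∑ i, parentInfo P i (Θ i)

end Information

section SpanningTree

/-- `E` is the set of edges of a spanning tree on the vertex set `ι`. -/
def IsSpanningTree {ι : Type*} (E : Finset (Sym2 ι)) : Prop :=
  (∀ e ∈ E, ¬ e.IsDiag) ∧ (SimpleGraph.fromEdgeSet (E : Set (Sym2 ι))).IsTree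

/-- `E` is a spanning tree of maximum total weight. -/
def IsMaxSpanningTree {ι : Type*} (w : Sym2 ι → ℝ≥0∞) (E : Finset (Sym2 ι)) : Prop :=
  IsSpanningTree E ∧
    ∀ E' : Finset (Sym2 ι), IsSpanningTree E' → ∑ e ∈ E', w e ≤ ∑ e ∈ E, w e

/-- `T` lists every pair of distinct vertices once, in an order of non-increasing weight. Pairs of
equal weight may come in any order. -/
def IsSortedPairList {ι : Type*} (w : Sym2 ι → ℝ≥0∞) (T : List (Sym2 ι)) : Prop :=
  T.Nodup ∧ (∀ e, e ∈ T ↔ ¬ e.IsDiag) ∧ T.Pairwise (fun e f => w f ≤ w e)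

/-- The loop of the algorithm: run through the list; skip a pair that would close a cycle with the
pairs chosen so far, otherwise choose it; stop as soon as the number of chosen pairs is the number
of vertices minus one. -/
noncomputable def chowLiuLoop {ι : Type*} [Fintype ι] :
    List (Sym2 ι) → Finset (Sym2 ι) → Finset (Sym2 ι)
  | [], E => E
  | e :: T, E =>
    open Classical in
    let E' : Finset (Sym2 ι) :=
      if (SimpleGraph.fromEdgeSet ((insert e E : Finset (Sym2 ι)) : Set (Sym2 ι))).IsAcyclic
      then insert e E else E
    if E'.card + 1 = Fintype.card ι then E' else chowLiuLoop T E'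

/-- The output of the Chow-Liu algorithm on a sorted list of pairs. -/
noncomputable def chowLiu {ι : Type*} [Fintype ι] (T : List (Sym2 ι)) : Finset (Sym2 ι) :=
  chowLiuLoop T ∅

end SpanningTree

/-- The joint law of the voltage increments at the non-slack buses. -/
noncomputable def voltageLaw {ι Ω : Type*} [MeasurableSpace Ω] (μ : Measure Ω)
    (V : Option ι → Ω → Phasor) : Measure (ι → Phasor) :=
  μ.map (fun ω i => V (some i) ω)

instance {ι Ω : Type*} [MeasurableSpace Ω] (μ : Measure Ω) [IsFiniteMeasure μ]
    (V : Option ι → Ω → Phasor) : IsFiniteMeasure (voltageLaw μ V) := by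
  unfold voltageLaw; infer_instance

end ChowLiuGrid

/-!
The divergence of a law `P` from its tree-structured approximation splits as
`D(P ‖ Q(·; Θ)) = D(P ‖ ∏ P_i) - ∑ I(i; Θ i)` (`klDiv_treeModel_add_sum`), because the logarithm of
the density of `Q(·; Θ)` relative to `∏ P_i` is a sum of log-densities of pairs, whose means under
`P` are the mutual informations. Only the sum depends on `Θ`, so that minimizing the divergence is
maximizing the total mutual information along the tree. All this needs just that `D(P ‖ ∏ P_i)` is
finite: data processing then bounds the mutual informations, and `Q(·; Θ)` has total mass one since
the buses can be integrated out from the leaves to the root (`lintegral_prod_condDensity`).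

The physics enters in the finiteness of `D(P ‖ ∏ P_i)` (`klDiv_voltageLaw_pi_ne_top`). A network
without injected currents carries no branch currents and has no voltages
(`RadialGrid.eq_zero_of_nodalMap_eq_zero`), so the voltages are a linear function of the independent
Gaussian currents, and `P` is a centered Gaussian law, nondegenerate on the product of the spaces
`S_i`. The law `∏ P_i` is of the same kind, and two such laws have finite divergence: in coordinates
both are linear images of the standard Gaussian law, whose density is the exponential of a quadratic
form (`klDiv_ne_top_of_isGaussian`).

The rest is combinatorial. The branches of a radial topology with a single feeder are a spanning
tree of the buses, every spanning tree arises in this way with an arbitrary feeding bus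
(`IsSpanningTree.exists_isRadial`), and a topology with several feeders is a forest, which can be
completed to a tree without losing information. The algorithm is the greedy choice of a spanning
tree; its correctness is the exchange argument (`IsSpanningTree.exists_exchange`,
`isMaxSpanningTree_chowLiuLoop`). If some topology reproduces `P`, the least divergence is zero and
every best-fitted topology reproduces `P`.
-/

namespace ChowLiuGrid

/-! ### Radial parent maps and spanning trees -/

section Radial

variable {ι : Type*} {Θ : ι → Option ι}

/-- A parent map is radial iff its buses can be numbered so that numbers decrease from a bus to
its parent. This is the form in which radiality is used for inductions along the tree. -/
theorem isRadial_iff_exists_depth :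
    IsRadial Θ ↔ ∃ d : ι → ℕ, ∀ i k, Θ i = some k → d k < d i := by
  classical
  constructor
  · intro h
    refine ⟨fun i => Nat.find (h i), fun i k hik => ?_⟩
    obtain ⟨m, hm⟩ : ∃ m, Nat.find (h i) = m + 1 := by
      refine Nat.exists_eq_succ_of_ne_zero fun h0 => ?_
      have := Nat.find_spec (h i)
      rw [h0] at this
      simp at this
    have hs := Nat.find_spec (h i)
    rw [hm, Function.iterate_succ_apply] at hs
    simp only [Option.bind_some, hik] at hs
    have : Nat.find (h k) ≤ m := Nat.find_min' (h k) hs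
    show Nat.find (h k) < Nat.find (h i)
    omega
  · rintro ⟨d, hd⟩ i
    induction hn : d i using Nat.strong_induction_on generalizing i with
    | _ n ih =>
      cases hi : Θ i with
      | none => exact ⟨1, by simp [hi]⟩
      | some k =>
        obtain ⟨m, hm⟩ := ih (d k) (hn ▸ hd i k hi) k rfl
        exact ⟨m + 1, by rw [Function.iterate_succ_apply]; simpa [hi] using hm⟩

theorem IsRadial.ne_of_eq_some (h : IsRadial Θ) {i k : ι} (hik : Θ i = some k) : i ≠ k := by
  obtain ⟨d, hd⟩ := isRadial_iff_exists_depth.1 h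
  rintro rfl
  exact lt_irrefl _ (hd _ _ hik)

/-- A branch of a radial topology feeds only one bus. -/
theorem IsRadial.eq_of_branch_eq (h : IsRadial Θ) {i k i' k' : ι} (hi : Θ i = some k)
    (hi' : Θ i' = some k') (he : s(i, k) = s(i', k')) : i = i' := by
  obtain ⟨d, hd⟩ := isRadial_iff_exists_depth.1 h
  rcases Sym2.eq_iff.1 he with ⟨h1, -⟩ | ⟨rfl, rfl⟩
  · exact h1
  · exact absurd (hd _ _ hi) (hd _ _ hi').le.not_gt

variable [Fintype ι]

theorem mem_branches {e : Sym2 ι} : e ∈ branches Θ ↔ ∃ i k : ι, Θ i = some k ∧ e = s(i, k) := by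
  simp [branches]

theorem IsRadial.not_isDiag_of_mem_branches (h : IsRadial Θ) {e : Sym2 ι} (he : e ∈ branches Θ) :
    ¬ e.IsDiag := by
  obtain ⟨i, k, hik, rfl⟩ := mem_branches.1 he
  simpa using h.ne_of_eq_some hik

theorem IsRadial.sum_branches (h : IsRadial Θ) {M : Type*} [AddCommMonoid M] (w : Sym2 ι → M) :
    ∑ e ∈ branches Θ, w e = ∑ i, (Θ i).elim 0 fun k => w s(i, k) := by
  classical
  have himg : branches Θ = (Finset.univ.filter fun i => Θ i ≠ none).image
      fun i => s(i, (Θ i).getD i) := by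
    ext e
    simp only [mem_branches, Finset.mem_image, Finset.mem_filter, Finset.mem_univ, true_and]
    constructor
    · rintro ⟨i, k, hik, rfl⟩
      exact ⟨i, by simp [hik], by simp [hik]⟩
    · rintro ⟨i, hi, rfl⟩
      obtain ⟨k, hk⟩ := Option.ne_none_iff_exists'.1 hi
      exact ⟨i, k, hk, by simp [hk]⟩
  rw [himg, Finset.sum_image]
  · rw [Finset.sum_filter]
    refine Finset.sum_congr rfl fun i _ => ?_
    cases hi : Θ i <;> simp
  · intro i hi i' hi' he
    simp only [Finset.coe_filter, Finset.mem_univ, true_and, Set.mem_ofPred_eq] at hi hi'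
    obtain ⟨k, hk⟩ := Option.ne_none_iff_exists'.1 hi
    obtain ⟨k', hk'⟩ := Option.ne_none_iff_exists'.1 hi'
    exact h.eq_of_branch_eq hk hk' (by simpa [hk, hk'] using he)

/-- Every bus that the substation does not feed accounts for one branch. -/
theorem IsRadial.card_branches_add (h : IsRadial Θ) [DecidablePred fun i => Θ i = none] :
    (branches Θ).card + (Finset.univ.filter fun i => Θ i = none).card = Fintype.card ι := by
  have h1 := h.sum_branches (fun _ => 1)
  rw [Finset.card_eq_sum_ones, h1, Finset.card_filter, ← Finset.sum_add_distrib,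
    ← Finset.card_univ, Finset.card_eq_sum_ones]
  refine Finset.sum_congr rfl fun i _ => ?_
  by_cases hi : Θ i = none
  · simp [hi]
  · obtain ⟨k, hk⟩ := Option.ne_none_iff_exists'.1 hi
    simp [hk]

theorem IsRadial.singleFeeder_iff_card (h : IsRadial Θ) :
    SingleFeeder Θ ↔ (branches Θ).card + 1 = Fintype.card ι := by
  classical
  have h1 := h.card_branches_add
  have h2 : SingleFeeder Θ ↔ (Finset.univ.filter fun i => Θ i = none).card = 1 := by
    rw [Finset.card_eq_one]
    simp only [SingleFeeder, ExistsUnique, Finset.ext_iff, Finset.mem_filter, Finset.mem_univ,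
      true_and, Finset.mem_singleton]
    exact ⟨fun ⟨i, hi, hu⟩ => ⟨i, fun a => ⟨hu a, fun ha => ha ▸ hi⟩⟩,
      fun ⟨i, hi⟩ => ⟨i, (hi i).2 rfl, fun a => (hi a).1⟩⟩
  rw [h2]
  omega

theorem isSpanningTree_iff_connected_and_card {E : Finset (Sym2 ι)} :
    IsSpanningTree E ↔ (∀ e ∈ E, ¬ e.IsDiag) ∧
      (SimpleGraph.fromEdgeSet (E : Set (Sym2 ι))).Connected ∧ E.card + 1 = Fintype.card ι := by
  refine and_congr_right fun hE => ?_
  have : (SimpleGraph.fromEdgeSet (E : Set (Sym2 ι))).edgeSet = E := by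
    rw [SimpleGraph.edgeSet_fromEdgeSet, sdiff_eq_left, Set.disjoint_left]
    exact fun e he hd => hE e he hd
  rw [SimpleGraph.isTree_iff_connected_and_card, this, Nat.card_eq_fintype_card]
  simp

theorem IsRadial.isSpanningTree_branches (h : IsRadial Θ) (hs : SingleFeeder Θ) :
    IsSpanningTree (branches Θ) := by
  refine isSpanningTree_iff_connected_and_card.2
    ⟨fun e => h.not_isDiag_of_mem_branches, ?_, h.singleFeeder_iff_card.1 hs⟩
  obtain ⟨r, hr, hu⟩ := hs
  obtain ⟨d, hd⟩ := isRadial_iff_exists_depth.1 h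
  rw [SimpleGraph.connected_iff_exists_forall_reachable]
  refine ⟨r, fun i => SimpleGraph.Reachable.symm ?_⟩
  induction hn : d i using Nat.strong_induction_on generalizing i with
  | _ n ih =>
    cases hi : Θ i with
    | none => rw [hu i hi]
    | some k =>
      refine SimpleGraph.Reachable.trans (SimpleGraph.Adj.reachable ?_)
        (ih (d k) (hn ▸ hd i k hi) k rfl)
      rw [SimpleGraph.fromEdgeSet_adj]
      exact ⟨Finset.mem_coe.2 (mem_branches.2 ⟨i, k, hi, rfl⟩), h.ne_of_eq_some hi⟩

/-- Rooting a spanning tree at any bus `r`: the parent of a bus is a neighbour that is closer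
to `r`. -/
theorem IsSpanningTree.exists_isRadial {E : Finset (Sym2 ι)} (hE : IsSpanningTree E) (r : ι) :
    ∃ Θ : ι → Option ι, IsRadial Θ ∧ SingleFeeder Θ ∧ Θ r = none ∧ branches Θ = E := by
  classical
  obtain ⟨-, hconn, hcard⟩ := isSpanningTree_iff_connected_and_card.1 hE
  set G := SimpleGraph.fromEdgeSet (E : Set (Sym2 ι))
  have hstep : ∀ i, i ≠ r → ∃ k, G.Adj i k ∧ G.dist k r < G.dist i r := by
    intro i hi
    obtain ⟨p, hp⟩ := hconn.exists_walk_length_eq_dist i r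
    cases p with
    | nil => exact absurd rfl hi
    | cons hadj q =>
      refine ⟨_, hadj, (SimpleGraph.dist_le q).trans_lt ?_⟩
      rw [← hp]
      simp
  choose! f hf using hstep
  let Θ : ι → Option ι := fun i => if i = r then none else some (f i)
  have hsome : ∀ i k, Θ i = some k → i ≠ r ∧ k = f i := by
    intro i k hik
    by_cases hi : i = r
    · simp [Θ, hi] at hik
    · simp only [Θ, hi, if_false, Option.some.injEq] at hik
      exact ⟨hi, hik.symm⟩
  have hrad : IsRadial Θ := by
    refine isRadial_iff_exists_depth.2 ⟨fun i => G.dist i r, fun i k hik => ?_⟩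
    obtain ⟨hi, rfl⟩ := hsome i k hik
    exact (hf i hi).2
  have hsf : SingleFeeder Θ := ⟨r, by simp [Θ], fun i hi => by
    by_contra hne
    simp [Θ, hne] at hi⟩
  refine ⟨Θ, hrad, hsf, by simp [Θ], ?_⟩
  -- both sets have one element less than there are buses
  refine Finset.eq_of_subset_of_card_le (fun e he => ?_) ?_
  · obtain ⟨i, k, hik, rfl⟩ := mem_branches.1 he
    obtain ⟨hi, rfl⟩ := hsome i k hik
    exact Finset.mem_coe.1 ((SimpleGraph.fromEdgeSet_adj _).1 (hf i hi).1).1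
  · have := hrad.singleFeeder_iff_card.1 hsf
    omega

end Radial

/-! ### Greedy choice of a maximum weight spanning tree -/

section Greedy

variable {ι : Type*} [Fintype ι]

/-- The exchange step: if the part `E` of a spanning tree `F` stays acyclic when the pair `e`
outside `F` is added, then `e` can replace a pair of `F` outside `E`. -/
theorem IsSpanningTree.exists_exchange [DecidableEq (Sym2 ι)] {E F : Finset (Sym2 ι)}
    (hF : IsSpanningTree F) (hEF : E ⊆ F) {e : Sym2 ι} (he : e ∉ F) (hd : ¬ e.IsDiag)
    (hac : (SimpleGraph.fromEdgeSet ((insert e E : Finset (Sym2 ι)) : Set (Sym2 ι))).IsAcyclic) :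
    ∃ f ∈ F, f ∉ E ∧ IsSpanningTree (insert e (F.erase f)) := by
  obtain ⟨hFd, hFconn, hFcard⟩ := isSpanningTree_iff_connected_and_card.1 hF
  set G := SimpleGraph.fromEdgeSet ((insert e F : Finset (Sym2 ι)) : Set (Sym2 ι))
  have hGconn : G.Connected :=
    hFconn.mono (SimpleGraph.fromEdgeSet_mono (by simp))
  -- a spanning tree between `E + e` and `F + e` misses exactly one pair of `F + e`
  obtain ⟨T, hET, hTG, hT⟩ := hGconn.exists_isTree_le_of_le_of_isAcyclic
    (SimpleGraph.fromEdgeSet_mono (by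
      simpa using Set.insert_subset_insert (Finset.coe_subset.2 hEF))) hac
  classical
  have hnd : ∀ g ∈ insert e F, ¬ g.IsDiag := by
    intro g hg
    rcases Finset.mem_insert.1 hg with rfl | hg
    exacts [hd, hFd g hg]
  have hTsub : T.edgeFinset ⊆ insert e F := by
    intro g hg
    have := SimpleGraph.edgeSet_mono hTG (SimpleGraph.mem_edgeFinset.1 hg)
    rw [SimpleGraph.edgeSet_fromEdgeSet] at this
    exact Finset.mem_coe.1 this.1
  have hEsub : insert e E ⊆ T.edgeFinset := by
    intro g hg
    rw [SimpleGraph.mem_edgeFinset]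
    apply SimpleGraph.edgeSet_mono hET
    rw [SimpleGraph.edgeSet_fromEdgeSet]
    exact ⟨Finset.mem_coe.2 hg, hnd g (Finset.insert_subset_insert e hEF hg)⟩
  have hTcard := hT.card_edgeFinset
  have hone : (insert e F \ T.edgeFinset).card = 1 := by
    rw [Finset.card_sdiff_of_subset hTsub, Finset.card_insert_of_notMem he]
    omega
  obtain ⟨f, hf⟩ := Finset.card_eq_one.1 hone
  have hfm : f ∈ insert e F ∧ f ∉ T.edgeFinset := by
    rw [← Finset.mem_sdiff, hf]; simp
  have hfe : f ≠ e := by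
    rintro rfl
    exact hfm.2 (hEsub (Finset.mem_insert_self _ _))
  have hTeq : insert e (F.erase f) = T.edgeFinset := by
    rw [← Finset.erase_insert_of_ne hfe.symm, Finset.erase_eq, ← hf,
      Finset.sdiff_sdiff_eq_self hTsub]
  refine ⟨f, (Finset.mem_insert.1 hfm.1).resolve_left hfe,
    fun hfE => hfm.2 (hEsub (Finset.mem_insert_of_mem hfE)), ?_, ?_⟩
  · intro g hg
    rw [hTeq] at hg
    exact hnd g (hTsub hg)
  · rw [hTeq]
    simpa using hT

theorem exists_isMaxSpanningTree [Nonempty ι] (w : Sym2 ι → ℝ≥0∞) :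
    ∃ F, IsMaxSpanningTree w F := by
  classical
  obtain ⟨T, -, hT⟩ := (SimpleGraph.connected_top (V := ι)).exists_isTree_le
  have hne : (Finset.univ.filter fun E : Finset (Sym2 ι) => IsSpanningTree E).Nonempty := by
    refine ⟨T.edgeFinset, Finset.mem_filter.2 ⟨Finset.mem_univ _, fun e he =>
      T.not_isDiag_of_mem_edgeSet (SimpleGraph.mem_edgeFinset.1 he), by simpa using hT⟩⟩
  obtain ⟨F, hF, hmax⟩ := Finset.exists_max_image _ (fun E => ∑ e ∈ E, w e) hne
  exact ⟨F, (Finset.mem_filter.1 hF).2, fun E' hE' => hmax E' (by simp [hE'])⟩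

/-- Loop invariant of the greedy algorithm: the pairs chosen so far belong to some maximum weight
spanning tree `F` all of whose other pairs are still to come. -/
theorem isMaxSpanningTree_chowLiuLoop {w : Sym2 ι → ℝ≥0∞} {T : List (Sym2 ι)}
    (hd : ∀ e ∈ T, ¬ e.IsDiag) (hs : T.Pairwise fun e f => w f ≤ w e)
    {E F : Finset (Sym2 ι)} (hF : IsMaxSpanningTree w F) (hEF : E ⊆ F)
    (hFT : ∀ f ∈ F, f ∉ E → f ∈ T) :
    IsMaxSpanningTree w (chowLiuLoop T E) := by
  classical
  induction T generalizing E F with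
  | nil =>
    have : F ⊆ E := fun f hf => by
      by_contra hfE
      simpa using hFT f hf hfE
    rw [chowLiuLoop, hEF.antisymm this]
    exact hF
  | cons e T ih =>
    obtain ⟨hse, hsT⟩ := List.pairwise_cons.1 hs
    obtain ⟨E', hE', F', hF', hEF', hFT'⟩ : ∃ E' : Finset (Sym2 ι),
        E' = (if (SimpleGraph.fromEdgeSet
          ((insert e E : Finset (Sym2 ι)) : Set (Sym2 ι))).IsAcyclic then insert e E else E) ∧
        ∃ F' : Finset (Sym2 ι), IsMaxSpanningTree w F' ∧ E' ⊆ F' ∧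
          ∀ f ∈ F', f ∉ E' → f ∈ T := by
      by_cases hac : (SimpleGraph.fromEdgeSet
          ((insert e E : Finset (Sym2 ι)) : Set (Sym2 ι))).IsAcyclic
      · refine ⟨insert e E, by rw [if_pos hac], ?_⟩
        by_cases heF : e ∈ F
        · refine ⟨F, hF, Finset.insert_subset heF hEF, fun f hf hfE => ?_⟩
          rw [Finset.mem_insert, not_or] at hfE
          exact (List.mem_cons.1 (hFT f hf hfE.2)).resolve_left hfE.1
        -- the pair `f` that `e` replaces is still to come, hence weighs at most as much
        · obtain ⟨f, hf, hfE, hst⟩ := hF.1.exists_exchange hEF heF (hd e (by simp)) hac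
          have hfT : f ∈ T :=
            (List.mem_cons.1 (hFT f hf hfE)).resolve_left (by rintro rfl; exact heF hf)
          refine ⟨insert e (F.erase f), ⟨hst, fun E'' hE'' => (hF.2 E'' hE'').trans ?_⟩, ?_, ?_⟩
          · rw [Finset.sum_insert (fun h => heF (Finset.mem_of_mem_erase h)),
              ← Finset.add_sum_erase F w hf]
            gcongr
            exact hse f hfT
          · exact Finset.insert_subset_insert e (Finset.subset_erase.2 ⟨hEF, hfE⟩)
          · intro g hg hgE
            rw [Finset.mem_insert, not_or] at hgE
            have hgF := Finset.mem_of_mem_erase ((Finset.mem_insert.1 hg).resolve_left hgE.1)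
            exact (List.mem_cons.1 (hFT g hgF hgE.2)).resolve_left hgE.1
      · refine ⟨E, by rw [if_neg hac], F, hF, hEF, fun f hf hfE => ?_⟩
        refine (List.mem_cons.1 (hFT f hf hfE)).resolve_left ?_
        rintro rfl
        exact hac (hF.1.2.isAcyclic.anti (SimpleGraph.fromEdgeSet_mono
          (Finset.coe_subset.2 (Finset.insert_subset hf hEF))))
    rw [chowLiuLoop]
    rw [show (if (SimpleGraph.fromEdgeSet ((insert e E : Finset (Sym2 ι)) :
      Set (Sym2 ι))).IsAcyclic then insert e E else E) = E' from by rw [hE']]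
    split_ifs with hcard
    -- a subset of the tree `F'` with as many pairs as a tree is `F'` itself
    · have := (isSpanningTree_iff_connected_and_card.1 hF'.1).2.2
      rw [Finset.eq_of_subset_of_card_le hEF' (by omega)]
      exact hF'
    · exact ih (fun g hg => hd g (List.mem_cons_of_mem _ hg)) hsT hF' hEF' hFT'

theorem isMaxSpanningTree_chowLiu [Nonempty ι] {w : Sym2 ι → ℝ≥0∞} {T : List (Sym2 ι)}
    (hT : IsSortedPairList w T) : IsMaxSpanningTree w (chowLiu T) := by
  obtain ⟨F, hF⟩ := exists_isMaxSpanningTree (ι := ι) w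
  exact isMaxSpanningTree_chowLiuLoop (fun e he => (hT.2.1 e).1 he) hT.2.2 hF
    (Finset.empty_subset _) fun f hf _ => (hT.2.1 f).2 (hF.1.1 f hf)

end Greedy

/-! ### Divergence of a law from its tree-structured approximations -/

section Density

variable {α β : Type*} [MeasurableSpace α] [MeasurableSpace β]

/-- The density of a joint law relative to the product of its marginals integrates to one in the
first variable, i.e. it defines a conditional law. -/
theorem ae_lintegral_rnDeriv_prod_eq_one {a : Measure α} {b : Measure β} [IsProbabilityMeasure a]
    [IsProbabilityMeasure b] {ρ : Measure (α × β)} [IsProbabilityMeasure ρ]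
    (hac : ρ ≪ a.prod b) (hb : ρ.map Prod.snd = b) :
    ∀ᵐ y ∂b, ∫⁻ x, ρ.rnDeriv (a.prod b) (x, y) ∂a = 1 := by
  have hm : Measurable (ρ.rnDeriv (a.prod b)) := Measure.measurable_rnDeriv _ _
  refine ae_eq_of_forall_setLIntegral_eq_of_sigmaFinite hm.lintegral_prod_left' measurable_const
    fun A hA _ => ?_
  have h := setLIntegral_prod_symm (μ := a) (ν := b) (s := Set.univ) (t := A) _
    hm.aemeasurable.restrict
  rw [Measure.restrict_univ] at h
  rw [setLIntegral_one, ← h, Measure.setLIntegral_rnDeriv hac, ← hb,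
    Measure.map_apply measurable_snd hA, Set.univ_prod]

/-- Passing from a reference measure `ν` to `ν.withDensity f` lowers the divergence of `μ` by the
mean of `log f`. -/
theorem toReal_klDiv_withDensity_right {μ ν : Measure α} [IsProbabilityMeasure μ]
    [IsProbabilityMeasure ν] (hkl : klDiv μ ν ≠ ∞) {f : α → ℝ≥0∞} (hf : Measurable f)
    [IsProbabilityMeasure (ν.withDensity f)] (hpos : ∀ᵐ x ∂μ, f x ≠ 0) (hfin : ∀ᵐ x ∂μ, f x ≠ ∞)
    (hint : Integrable (fun x => Real.log (f x).toReal) μ) :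
    klDiv μ (ν.withDensity f) ≠ ∞ ∧
      (klDiv μ (ν.withDensity f)).toReal + ∫ x, Real.log (f x).toReal ∂μ = (klDiv μ ν).toReal := by
  obtain ⟨hac, hll⟩ := klDiv_ne_top_iff.1 hkl
  have hac' : μ ≪ ν.withDensity f := by
    refine Measure.AbsolutelyContinuous.mk fun s hs h0 => ?_
    rw [withDensity_apply _ hs, lintegral_eq_zero_iff hf] at h0
    have h1 : ∀ᵐ x ∂ν, x ∈ s → f x = 0 := (ae_restrict_iff' hs).1 h0
    have h2 : ∀ᵐ x ∂μ, x ∉ s := by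
      filter_upwards [hac.ae_le h1, hpos] with x hx hx' hxs using hx' (hx hxs)
    simpa [ae_iff] using h2
  have hllr : llr μ (ν.withDensity f) =ᵐ[μ] fun x => llr μ ν x - Real.log (f x).toReal := by
    filter_upwards [hac.ae_le (Measure.rnDeriv_mul_rnDeriv (κ := ν) hac'),
      hac.ae_le (Measure.rnDeriv_withDensity ν hf), hpos, hfin, Measure.rnDeriv_pos hac',
      hac'.ae_le (Measure.rnDeriv_ne_top μ (ν.withDensity f))] with x h1 h2 h3 h4 h5 h6
    rw [llr, llr, ← h1, Pi.mul_apply, h2, ENNReal.toReal_mul, Real.log_mul]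
    · ring
    · exact (ENNReal.toReal_pos h5.ne' h6).ne'
    · exact (ENNReal.toReal_pos h3 h4).ne'
  have hI : Integrable (llr μ (ν.withDensity f)) μ := (hll.sub hint).congr hllr.symm
  refine ⟨klDiv_ne_top hac' hI, ?_⟩
  rw [toReal_klDiv_of_measure_eq hac' (by simp), toReal_klDiv_of_measure_eq hac (by simp),
    integral_congr_ae hllr, integral_sub hll hint]
  ring

/-- Under a product measure, a factor `h (v i, v k)` that is a probability density in `v i` can be
integrated out if no other factor depends on `v i`. -/
theorem lintegral_pi_mul_of_update_eq {ι : Type*} [Fintype ι] {m : ι → Measure α}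
    [∀ i, IsProbabilityMeasure (m i)] {i k : ι} (hik : i ≠ k) {g : (ι → α) → ℝ≥0∞}
    (hg : Measurable g) [DecidableEq ι] (hgi : ∀ v x, g (Function.update v i x) = g v)
    {h : α × α → ℝ≥0∞} (hh : Measurable h) (h1 : ∀ᵐ y ∂m k, ∫⁻ x, h (x, y) ∂m i = 1) :
    ∫⁻ v, h (v i, v k) * g v ∂Measure.pi m = ∫⁻ v, g v ∂Measure.pi m := by
  set F : (ι → α) → ℝ≥0∞ := fun v => h (v i, v k) * g v
  have hF : Measurable F := by fun_prop
  have hmarg : ∀ v, (∫⋯∫⁻_{i}, F ∂m) v = (∫⁻ x, h (x, v k) ∂m i) * g v := by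
    intro v
    rw [lmarginal_singleton]
    simp only [F, hgi, Function.update_self, Function.update_of_ne hik.symm]
    rw [lintegral_mul_const]
    fun_prop
  -- the integral over `v i` may be carried out first, and again without effect
  have hstep : ∫⁻ v, F v ∂Measure.pi m = ∫⁻ v, (∫⋯∫⁻_{i}, F ∂m) v ∂Measure.pi m := by
    refine lintegral_eq_of_lmarginal_eq {i} hF (hF.lmarginal m) ?_
    ext v
    rw [lmarginal_singleton (∫⋯∫⁻_{i}, F ∂m) i]
    simp only [hmarg, hgi, Function.update_of_ne hik.symm]
    simp
  rw [hstep]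
  refine lintegral_congr_ae ?_
  filter_upwards [(measurePreserving_eval m k).quasiMeasurePreserving.ae h1] with v hv
  rw [hmarg, hv, one_mul]

end Density

section Tree

variable {ι : Type*} {P : Measure (ι → Phasor)}

theorem measurable_condDensity (i : ι) (b : Option ι) : Measurable (condDensity P i b) := by
  cases b with
  | none => exact measurable_const
  | some k =>
    exact (Measure.measurable_rnDeriv _ _).comp
      (show Measurable fun v : ι → Phasor => (v i, v k) by fun_prop)

theorem condDensity_update [DecidableEq ι] {i j : ι} {b : Option ι} (hj : j ≠ i) (hb : b ≠ some i)
    (v : ι → Phasor) (x : Phasor) :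
    condDensity P j b (Function.update v i x) = condDensity P j b v := by
  cases b with
  | none => rfl
  | some k =>
    have hk : k ≠ i := fun h => hb (by rw [h])
    simp [condDensity, Function.update_of_ne hj, Function.update_of_ne hk]

theorem IsRadial.parentInfo_ne_top (hfin : ∀ i k, i ≠ k → mutualInfo P i k ≠ ∞)
    {Θ : ι → Option ι} (hΘ : IsRadial Θ) (i : ι) : parentInfo P i (Θ i) ≠ ∞ := by
  cases hi : Θ i with
  | none => simp [parentInfo]
  | some k => exact hfin i k (hΘ.ne_of_eq_some hi)

variable [IsProbabilityMeasure P]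

instance isProbabilityMeasure_map_eval (i : ι) :
    IsProbabilityMeasure (P.map fun v => v i) :=
  Measure.isProbabilityMeasure_map (measurable_pi_apply i).aemeasurable

instance isProbabilityMeasure_map_pair (i k : ι) :
    IsProbabilityMeasure (P.map fun v => (v i, v k)) :=
  Measure.isProbabilityMeasure_map (by fun_prop)

/-- The facts about one factor of a tree-structured law: it is positive and finite almost surely,
and the mean of its logarithm is the mutual information. -/
theorem log_condDensity {i : ι} {b : Option ι} (hb : parentInfo P i b ≠ ∞) :
    (∀ᵐ v ∂P, condDensity P i b v ≠ 0) ∧ (∀ᵐ v ∂P, condDensity P i b v ≠ ∞) ∧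
      Integrable (fun v => Real.log (condDensity P i b v).toReal) P ∧
      ∫ v, Real.log (condDensity P i b v).toReal ∂P = (parentInfo P i b).toReal := by
  cases b with
  | none => simp [condDensity, parentInfo]
  | some k =>
    obtain ⟨hac, hint⟩ := klDiv_ne_top_iff.1 hb
    have hm : Measurable fun v : ι → Phasor => (v i, v k) := by fun_prop
    refine ⟨?_, ?_, ?_, ?_⟩
    · filter_upwards [ae_of_ae_map hm.aemeasurable (Measure.rnDeriv_pos hac)] with v hv
        using hv.ne'
    · exact ae_of_ae_map hm.aemeasurable (hac.ae_le (Measure.rnDeriv_ne_top _ _))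
    · exact hint.comp_measurable hm
    · rw [parentInfo, mutualInfo, toReal_klDiv_of_measure_eq hac (by simp),
        integral_map hm.aemeasurable (by fun_prop)]
      rfl

variable [Fintype ι]

theorem map_pair_pi {i k : ι} (hik : i ≠ k) (m : ι → Measure Phasor)
    [∀ i, IsProbabilityMeasure (m i)] :
    (Measure.pi m).map (fun v => (v i, v k)) = (m i).prod (m k) := by
  have h : IndepFun (fun v : ι → Phasor => v i) (fun v => v k) (Measure.pi m) :=
    (iIndepFun_pi (μ := m) (X := fun _ => id) fun i => aemeasurable_id).indepFun hik
  rw [indepFun_iff_map_prod_eq_prod_map_map (measurable_pi_apply i).aemeasurable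
    (measurable_pi_apply k).aemeasurable] at h
  rw [h, (measurePreserving_eval m i).map_eq, (measurePreserving_eval m k).map_eq]

/-- The mutual information of two coordinates is bounded by the divergence of the joint law from
the product of all marginals, by data processing. -/
theorem mutualInfo_le_klDiv_pi {i k : ι} (hik : i ≠ k) :
    mutualInfo P i k ≤ klDiv P (Measure.pi fun i => P.map fun v => v i) := by
  rw [mutualInfo, ← map_pair_pi hik fun i => P.map fun v => v i]
  exact klDiv_map_le _ _ ((measurable_pi_apply i).prodMk (measurable_pi_apply k))

variable {Θ : ι → Option ι}

/-- Integrating out the buses one by one, a bus after all buses that it feeds. -/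
theorem lintegral_prod_condDensity (hfin : ∀ i k, i ≠ k → mutualInfo P i k ≠ ∞)
    (hΘ : IsRadial Θ) (s : Finset ι) (hs : ∀ i ∈ s, ∀ k, Θ i = some k → k ∈ s) :
    ∫⁻ v, ∏ i ∈ s, condDensity P i (Θ i) v ∂(Measure.pi fun i => P.map fun v => v i) = 1 := by
  classical
  obtain ⟨d, hd⟩ := isRadial_iff_exists_depth.1 hΘ
  induction s using Finset.strongInduction with
  | H s ih =>
    rcases s.eq_empty_or_nonempty with rfl | hne
    · simp
    -- a bus of greatest depth feeds no bus of `s`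
    obtain ⟨i, hi, hmax⟩ := Finset.exists_max_image s d hne
    have hleaf : ∀ j ∈ s, Θ j ≠ some i := fun j hj hji => (hd j i hji).not_ge (hmax j hj)
    rw [← ih (s.erase i) (Finset.erase_ssubset hi) fun j hj k hk =>
      Finset.mem_erase.2 ⟨fun h => hleaf j (Finset.mem_of_mem_erase hj) (h ▸ hk),
        hs j (Finset.mem_of_mem_erase hj) k hk⟩]
    simp_rw [← Finset.mul_prod_erase s (fun i => condDensity P i (Θ i) _) hi]
    cases hΘi : Θ i with
    | none => simp [condDensity]
    | some k =>
      have hik := hΘ.ne_of_eq_some hΘi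
      refine lintegral_pi_mul_of_update_eq (m := fun i => P.map fun v => v i) hik
        (Finset.measurable_prod _ fun j _ => measurable_condDensity j _) (fun v x => ?_)
        (Measure.measurable_rnDeriv _ _) ?_
      · refine Finset.prod_congr rfl fun j hj => condDensity_update (Finset.ne_of_mem_erase hj)
          (hleaf j (Finset.mem_of_mem_erase hj)) v x
      · refine ae_lintegral_rnDeriv_prod_eq_one (klDiv_ne_top_iff.1 (hfin i k hik)).1 ?_
        rw [Measure.map_map (by fun_prop) (by fun_prop)]
        rfl

theorem isProbabilityMeasure_treeModel (hfin : ∀ i k, i ≠ k → mutualInfo P i k ≠ ∞)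
    (hΘ : IsRadial Θ) : IsProbabilityMeasure (treeModel P Θ) := by
  refine ⟨?_⟩
  rw [treeModel, withDensity_apply _ MeasurableSet.univ, Measure.restrict_univ]
  exact lintegral_prod_condDensity hfin hΘ Finset.univ (by simp)

/-- The divergence from a tree-structured law and the sum of the mutual informations along the tree
add up to a quantity that does not depend on the tree. -/
theorem klDiv_treeModel_add_sum
    (hkl : klDiv P (Measure.pi fun i => P.map fun v => v i) ≠ ∞) (hΘ : IsRadial Θ) :
    klDiv P (treeModel P Θ) ≠ ∞ ∧ klDiv P (treeModel P Θ) + ∑ i, parentInfo P i (Θ i) =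
      klDiv P (Measure.pi fun i => P.map fun v => v i) := by
  have hfin : ∀ i k, i ≠ k → mutualInfo P i k ≠ ∞ :=
    fun i k hik => ne_top_of_le_ne_top hkl (mutualInfo_le_klDiv_pi hik)
  have hpi := hΘ.parentInfo_ne_top hfin
  have hprob := isProbabilityMeasure_treeModel hfin hΘ
  rw [treeModel] at hprob
  have hc := fun i => log_condDensity (hpi i)
  have hpos : ∀ᵐ v ∂P, ∀ i, condDensity P i (Θ i) v ≠ 0 := ae_all_iff.2 fun i => (hc i).1
  have hlt : ∀ᵐ v ∂P, ∀ i, condDensity P i (Θ i) v ≠ ∞ := ae_all_iff.2 fun i => (hc i).2.1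
  have hlog : (fun v => Real.log (∏ i, condDensity P i (Θ i) v).toReal) =ᵐ[P]
      fun v => ∑ i, Real.log (condDensity P i (Θ i) v).toReal := by
    filter_upwards [hpos, hlt] with v h0 h1
    rw [ENNReal.toReal_prod, Real.log_prod fun i _ => (ENNReal.toReal_pos (h0 i) (h1 i)).ne']
  have hint : Integrable (fun v => ∑ i, Real.log (condDensity P i (Θ i) v).toReal) P :=
    integrable_finsetSum _ fun i _ => (hc i).2.2.1
  obtain ⟨h1, h2⟩ := toReal_klDiv_withDensity_right hkl
    (f := fun v => ∏ i, condDensity P i (Θ i) v)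
    (Finset.measurable_prod _ fun j _ => measurable_condDensity j _)
    (by filter_upwards [hpos] with v hv using Finset.prod_ne_zero_iff.2 fun i _ => hv i)
    (by filter_upwards [hlt] with v hv using ENNReal.prod_ne_top fun i _ => hv i)
    (hint.congr hlog.symm)
  refine ⟨h1, ?_⟩
  have hsum : ∑ i, parentInfo P i (Θ i) ≠ ∞ := ENNReal.sum_ne_top.2 fun i _ => hpi i
  rw [treeModel, ← ENNReal.toReal_eq_toReal_iff' (ENNReal.add_ne_top.2 ⟨h1, hsum⟩) hkl,
    ENNReal.toReal_add h1 hsum, ← h2, integral_congr_ae hlog,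
    integral_finsetSum _ fun i _ => (hc i).2.2.1, ENNReal.toReal_sum fun i _ => hpi i]
  simp_rw [(hc _).2.2.2]

end Tree

/-! ### Divergence between Gaussian laws -/

section Gaussian

open scoped RealInnerProductSpace MatrixOrder

theorem map_tilted {α β : Type*} [MeasurableSpace α] [MeasurableSpace β] (μ : Measure α)
    (e : α ≃ᵐ β) (f : α → ℝ) : (μ.tilted f).map e = (μ.map e).tilted (f ∘ e.symm) := by
  ext s hs
  rw [e.map_apply, tilted_apply' _ _ (e.measurable hs), tilted_apply' _ _ hs,
    MeasurableEquiv.restrict_map, lintegral_map_equiv]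
  simp [integral_map_equiv]

/-- Tilting normalizes, so that a constant factor of the measure has no effect. -/
theorem smul_tilted {α : Type*} [MeasurableSpace α] (μ : Measure α) {c : ℝ≥0∞} (h0 : c ≠ 0)
    (hc : c ≠ ∞) (f : α → ℝ) : (c • μ).tilted f = μ.tilted f := by
  have h : c.toReal ≠ 0 := (ENNReal.toReal_pos h0 hc).ne'
  ext s hs
  rw [tilted_apply' _ _ hs, tilted_apply' _ _ hs, integral_smul_measure, Measure.restrict_smul,
    lintegral_smul_measure, smul_eq_mul, smul_eq_mul, ← lintegral_const_mul' _ _ hc]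
  refine lintegral_congr fun x => ?_
  nth_rw 1 [← ENNReal.ofReal_toReal hc]
  rw [← ENNReal.ofReal_mul ENNReal.toReal_nonneg]
  congr 1
  rw [mul_div_assoc', mul_div_mul_left _ _ h]

variable {E : Type*} [NormedAddCommGroup E] [InnerProductSpace ℝ E] [FiniteDimensional ℝ E]
  [MeasurableSpace E] [BorelSpace E]

theorem integrable_exp_neg_sq_norm : Integrable fun x : E => Real.exp (-‖x‖ ^ 2 / 2) := by
  have h := GaussianFourier.integrable_cexp_neg_mul_sq_norm_add (V := E) (b := 1 / 2)
    (by norm_num) 0 0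
  refine h.norm.congr (ae_of_all _ fun x => ?_)
  beta_reduce
  rw [Complex.norm_exp]
  congr 1
  simp [← Complex.ofReal_pow]
  ring

/-- The density of the standard Gaussian law, identified by its characteristic function. -/
theorem stdGaussian_eq_tilted :
    stdGaussian E = (volume : Measure E).tilted fun x => -‖x‖ ^ 2 / 2 := by
  have hprob := isProbabilityMeasure_tilted (integrable_exp_neg_sq_norm (E := E))
  refine Measure.ext_of_charFun (E := E) ?_
  ext t
  have h0 := GaussianFourier.integral_cexp_neg_mul_sq_norm_add (V := E) (b := 1 / 2)
    (by norm_num) 0 0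
  have ht := GaussianFourier.integral_cexp_neg_mul_sq_norm_add (V := E) (b := 1 / 2)
    (by norm_num) Complex.I t
  set Z := ((Real.pi : ℂ) / (1 / 2)) ^ (Module.finrank ℝ E / 2 : ℂ)
  have hZ : ((∫ x : E, Real.exp (-‖x‖ ^ 2 / 2) : ℝ) : ℂ) = Z := by
    rw [← integral_complex_ofReal]
    simp only [inner_zero_left, norm_zero, Complex.ofReal_zero] at h0
    rw [show Z = Z * Complex.exp (0 ^ 2 * 0 ^ 2 / (4 * (1 / 2))) by simp, ← h0]
    refine integral_congr_ae (ae_of_all _ fun x => ?_)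
    simp only [Complex.ofReal_exp]
    congr 1
    push_cast
    ring
  have hZ0 : Z ≠ 0 := by
    rw [← hZ, Complex.ofReal_ne_zero]
    exact (integral_exp_pos integrable_exp_neg_sq_norm).ne'
  rw [charFun_stdGaussian, charFun_apply, integral_tilted]
  have : ∀ x : E, (Real.exp (-‖x‖ ^ 2 / 2) / ∫ x : E, Real.exp (-‖x‖ ^ 2 / 2)) •
      Complex.exp (⟪x, t⟫ * Complex.I) =
      Complex.exp (-(1 / 2) * ‖x‖ ^ 2 + Complex.I * ⟪t, x⟫) / Z := by
    intro x
    rw [Complex.real_smul, Complex.ofReal_div, hZ, Complex.ofReal_exp, div_mul_eq_mul_div,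
      ← Complex.exp_add, real_inner_comm]
    congr 2
    push_cast
    ring
  simp_rw [this]
  rw [integral_div, ht, mul_div_cancel_left₀ _ hZ0]
  congr 1
  rw [Complex.I_sq]
  ring

/-- The constant `|det A|` by which a linear map changes volumes disappears in the normalization. -/
theorem map_stdGaussian_eq_tilted (A : E ≃L[ℝ] E) :
    (stdGaussian E).map A =
      (stdGaussian E).tilted fun x => ‖x‖ ^ 2 / 2 - ‖A.symm x‖ ^ 2 / 2 := by
  have hdet : LinearMap.det (A : E →ₗ[ℝ] E) ≠ 0 :=
    (LinearEquiv.isUnit_det' A.toLinearEquiv).ne_zero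
  have hvol : (volume : Measure E).map A =
      ENNReal.ofReal |(LinearMap.det (A : E →ₗ[ℝ] E))⁻¹| • volume :=
    Measure.map_linearMap_addHaar_eq_smul_addHaar volume hdet
  rw [stdGaussian_eq_tilted, tilted_tilted integrable_exp_neg_sq_norm]
  have h := map_tilted (volume : Measure E) A.toHomeomorph.toMeasurableEquiv
    fun x => -‖x‖ ^ 2 / 2
  have hcoe : ⇑A.toHomeomorph.toMeasurableEquiv = A := rfl
  rw [hcoe, hvol, smul_tilted] at h
  · rw [h]
    congr 1
    ext x
    simp only [Function.comp_apply, Pi.add_apply]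
    change -‖A.symm x‖ ^ 2 / 2 = _
    ring
  · simpa using hdet
  · exact ENNReal.ofReal_ne_top

/-- The logarithm of the density is a quadratic form, which Gaussian laws integrate. -/
theorem klDiv_map_stdGaussian_ne_top (A : E ≃L[ℝ] E) :
    klDiv ((stdGaussian E).map A) (stdGaussian E) ≠ ∞ := by
  set f : E → ℝ := fun x => ‖x‖ ^ 2 / 2 - ‖A.symm x‖ ^ 2 / 2
  have hmap := map_stdGaussian_eq_tilted A
  have hprob : IsProbabilityMeasure ((stdGaussian E).map A) :=
    Measure.isProbabilityMeasure_map (by fun_prop)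
  have hexp : Integrable (fun x => Real.exp (f x)) (stdGaussian E) := by
    -- a tilted measure is zero by convention if the exponential is not integrable
    by_contra h
    rw [hmap, tilted_of_not_integrable h] at hprob
    exact hprob.ne_zero _ rfl
  have hac : (stdGaussian E).map A ≪ stdGaussian E := hmap ▸ tilted_absolutelyContinuous _ _
  refine klDiv_ne_top hac ?_
  have hll : llr ((stdGaussian E).map A) (stdGaussian E) =ᵐ[(stdGaussian E).map A]
      fun x => f x - Real.log (∫ z, Real.exp (f z) ∂stdGaussian E) := by
    refine hac.ae_le ?_
    rw [hmap]
    filter_upwards [llr_tilted_left (Measure.AbsolutelyContinuous.refl (stdGaussian E)) hexp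
      (by fun_prop), llr_self (stdGaussian E)] with x h1 h2
    rw [h1, h2]
    simp
  have hg : IsGaussian ((stdGaussian E).map A) := isGaussian_map (A : E →L[ℝ] E)
  have hid : MemLp id 2 ((stdGaussian E).map A) := IsGaussian.memLp_two_id
  refine Integrable.congr ?_ hll.symm
  refine Integrable.sub (Integrable.sub ?_ ?_) (integrable_const _)
  · exact (hid.norm.integrable_sq).div_const 2
  · exact (((A.symm : E →L[ℝ] E).comp_memLp' hid).norm.integrable_sq).div_const 2

/-- A nondegenerate centered Gaussian law is a linear image of the standard one. -/
theorem exists_map_stdGaussian_eq {d : Type*} [Fintype d] {ν : Measure (EuclideanSpace ℝ d)}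
    [IsGaussian ν] (hmean : ∫ x, x ∂ν = 0)
    (hvar : ∀ x : EuclideanSpace ℝ d, x ≠ 0 → Var[fun u => ⟪x, u⟫; ν] ≠ 0) :
    ∃ A : EuclideanSpace ℝ d ≃L[ℝ] EuclideanSpace ℝ d,
      ν = (stdGaussian (EuclideanSpace ℝ d)).map A := by
  classical
  let b := EuclideanSpace.basisFun d ℝ
  let S : Matrix d d ℝ := fun i j => covarianceBilin ν (b i) (b j)
  have hS : ∀ x y : EuclideanSpace ℝ d,
      x.ofLp ⬝ᵥ S.mulVec y.ofLp = covarianceBilin ν x y := by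
    intro x y
    conv_rhs => rw [← b.sum_repr x, ← b.sum_repr y]
    simp only [S, b, dotProduct, Matrix.mulVec, Finset.mul_sum, map_sum, map_smul,
      _root_.sum_apply, _root_.smul_apply, smul_eq_mul,
      EuclideanSpace.basisFun_repr]
    rw [Finset.sum_comm]
    exact Finset.sum_congr rfl fun i _ => Finset.sum_congr rfl fun k _ => by ring
  have hpsd : S.PosSemidef := by
    refine Matrix.PosSemidef.of_dotProduct_mulVec_nonneg ?_ fun x => ?_
    · ext i j
      exact covarianceBilin_comm _ _
    · have := hS (WithLp.toLp 2 x) (WithLp.toLp 2 x)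
      simp only [star_trivial]
      rw [this]
      exact covarianceBilin_self_nonneg _
  set B := Matrix.toEuclideanCLM (𝕜 := ℝ) (n := d) (CFC.sqrt S)
  -- the square root of the covariance is injective, since a kernel vector would have variance zero
  have hinj : Function.Injective B := by
    rw [injective_iff_map_eq_zero]
    intro x hx
    by_contra hne
    refine hvar x hne ?_
    have hBB : B * B = Matrix.toEuclideanCLM (𝕜 := ℝ) S := by
      rw [← map_mul, CFC.sqrt_mul_sqrt_self _ hpsd.nonneg]
    have h0 : Matrix.toEuclideanCLM (𝕜 := ℝ) S x = 0 := by
      rw [← hBB, mul_apply_eq_comp, hx, map_zero]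
    rw [← covarianceBilin_self IsGaussian.memLp_two_id, ← hS, ← Matrix.inner_toEuclideanCLM, h0,
      inner_zero_right]
  refine ⟨(LinearEquiv.ofInjectiveEndo B.toLinearMap hinj).toContinuousLinearEquiv, ?_⟩
  have hν : ν = multivariateGaussian 0 S := by
    refine IsGaussian.ext ?_ ?_
    · simpa using hmean
    · ext x y
      rw [covarianceBilin_multivariateGaussian hpsd, hS]
  rw [hν, multivariateGaussian]
  congr 1
  ext x
  simp
  rfl

/-- Two centered Gaussian laws that are concentrated on a subspace and nondegenerate there have
finite divergence. In coordinates of the subspace, both are linear images of the standard Gaussian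
law. -/
theorem klDiv_ne_top_of_isGaussian {F : Type*} [NormedAddCommGroup F] [NormedSpace ℝ F]
    [FiniteDimensional ℝ F] [MeasurableSpace F] [BorelSpace F] {P Q : Measure F} [IsGaussian P]
    [IsGaussian Q] (S : Submodule ℝ F) (hP : ∀ᵐ x ∂P, x ∈ S) (hQ : ∀ᵐ x ∂Q, x ∈ S)
    (hPm : ∫ x, x ∂P = 0) (hQm : ∫ x, x ∂Q = 0)
    (hPv : ∀ L : F →L[ℝ] ℝ, (∃ x ∈ S, L x ≠ 0) → Var[L; P] ≠ 0)
    (hQv : ∀ L : F →L[ℝ] ℝ, (∃ x ∈ S, L x ≠ 0) → Var[L; Q] ≠ 0) :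
    klDiv P Q ≠ ∞ := by
  let X := EuclideanSpace ℝ (Fin (Module.finrank ℝ S))
  let e : S ≃ₗ[ℝ] X := LinearEquiv.ofFinrankEq _ _ (by simp [X])
  obtain ⟨c', hc'⟩ := LinearMap.exists_extend (e : S →ₗ[ℝ] X)
  let c : F →L[ℝ] X := LinearMap.toContinuousLinearMap c'
  let j : X →L[ℝ] F := LinearMap.toContinuousLinearMap (S.subtype ∘ₗ (e.symm : X →ₗ[ℝ] S))
  have hc : ∀ x : S, c x = e x := fun x => LinearMap.congr_fun hc' x
  have hjS : ∀ y, j y ∈ S := fun y => (e.symm y).2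
  have hcj : ∀ y, c (j y) = y := fun y => by
    rw [show j y = ((e.symm y : S) : F) from rfl, hc, e.apply_symm_apply]
  have hjc : ∀ x ∈ S, j (c x) = x := fun x hx => by
    rw [hc ⟨x, hx⟩]
    show ((e.symm (e ⟨x, hx⟩) : S) : F) = x
    rw [e.symm_apply_apply]
  -- a law on `S` is recovered from its law in coordinates
  have hback : ∀ ν : Measure F, (∀ᵐ x ∂ν, x ∈ S) → (ν.map c).map j = ν := by
    intro ν hν
    rw [Measure.map_map (by fun_prop) (by fun_prop)]
    conv_rhs => rw [← Measure.map_id (μ := ν)]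
    refine Measure.map_congr ?_
    filter_upwards [hν] with x hx using hjc x hx
  have hstd : ∀ ν : Measure F, IsGaussian ν → ∫ x, x ∂ν = 0 →
      (∀ L : F →L[ℝ] ℝ, (∃ x ∈ S, L x ≠ 0) → Var[L; ν] ≠ 0) →
      ∃ A : X ≃L[ℝ] X, ν.map c = (stdGaussian X).map A := by
    intro ν hν hνm hνv
    have : IsGaussian (ν.map c) := isGaussian_map c
    refine exists_map_stdGaussian_eq ?_ fun x hx => ?_
    · rw [c.integral_id_map IsGaussian.integrable_id, hνm, map_zero]
    · rw [variance_map (by fun_prop) (by fun_prop)]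
      refine hνv ((innerSL ℝ x).comp c) ⟨j x, hjS x, ?_⟩
      simpa [hcj] using hx
  obtain ⟨A, hA⟩ := hstd P inferInstance hPm hPv
  obtain ⟨B, hB⟩ := hstd Q inferInstance hQm hQv
  have h1 : klDiv (P.map c) (Q.map c) ≠ ∞ := by
    refine ne_top_of_le_ne_top (klDiv_map_stdGaussian_ne_top (A.trans B.symm)) ?_
    have h := klDiv_map_le ((stdGaussian X).map (A.trans B.symm)) (stdGaussian X)
      (g := B) (by fun_prop)
    have hBA : B ∘ A.trans B.symm = A := funext fun x => B.apply_symm_apply (A x)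
    rw [Measure.map_map (by fun_prop) (by fun_prop), hBA] at h
    rwa [hA, hB]
  refine ne_top_of_le_ne_top h1 ?_
  have h := klDiv_map_le (P.map c) (Q.map c) (g := j) (by fun_prop)
  rwa [hback P hP, hback Q hQ] at h

end Gaussian

section Product

variable {ι : Type*} [Fintype ι]

/-- Independent random vectors that are nondegenerate on subspaces are jointly nondegenerate on
the product of the subspaces. -/
theorem variance_pi_ne_zero {Ω : Type*} [MeasurableSpace Ω] {μ : Measure Ω}
    {X : ι → Ω → Phasor} (hind : iIndepFun X μ) (hL2 : ∀ i, MemLp (X i) 2 μ)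
    (S : ι → Submodule ℝ Phasor)
    (hvar : ∀ i, ∀ L : Phasor →L[ℝ] ℝ, (∃ x ∈ S i, L x ≠ 0) →
      variance (fun ω => L (X i ω)) μ ≠ 0)
    (L : (ι → Phasor) →L[ℝ] ℝ) (hL : ∃ x ∈ Submodule.pi Set.univ S, L x ≠ 0) :
    variance (fun ω => L fun i => X i ω) μ ≠ 0 := by
  classical
  let Li : ι → Phasor →L[ℝ] ℝ := fun i =>
    L.comp (ContinuousLinearMap.single ℝ (fun _ : ι => Phasor) i)
  have hsum : ∀ x : ι → Phasor, L x = ∑ i, Li i (x i) := by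
    intro x
    conv_lhs => rw [← Finset.univ_sum_single x, map_sum]
    rfl
  have hX : (fun ω => L fun i => X i ω) = ∑ i, fun ω => Li i (X i ω) := by
    ext ω
    rw [hsum, Finset.sum_apply]
  have hL2' : ∀ i, MemLp (fun ω => Li i (X i ω)) 2 μ := fun i => (Li i).comp_memLp' (hL2 i)
  rw [hX, IndepFun.variance_sum (fun i _ => hL2' i) fun i _ k _ hik =>
    (hind.indepFun hik).comp (Li i).measurable (Li k).measurable]
  obtain ⟨x, hx, hLx⟩ := hL
  rw [hsum] at hLx
  obtain ⟨i, -, hi⟩ := Finset.exists_ne_zero_of_sum_ne_zero hLx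
  have hpos : 0 < variance (fun ω => Li i (X i ω)) μ :=
    (variance_nonneg _ _).lt_of_ne (hvar i (Li i) ⟨x i, hx i trivial, hi⟩).symm
  exact (hpos.trans_le (Finset.single_le_sum (f := fun i => variance (fun ω => Li i (X i ω)) μ)
    (fun k _ => variance_nonneg _ _) (Finset.mem_univ i))).ne'

/-- A nondegenerate centered Gaussian law has finite divergence from the product of its marginals,
which is a law of the same kind. -/
theorem klDiv_pi_ne_top_of_isGaussian {P : Measure (ι → Phasor)} [IsGaussian P]
    (S : ι → Submodule ℝ Phasor) (hS : ∀ᵐ v ∂P, v ∈ Submodule.pi Set.univ S)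
    (hmean : ∫ v, v ∂P = 0)
    (hvar : ∀ L : (ι → Phasor) →L[ℝ] ℝ, (∃ x ∈ Submodule.pi Set.univ S, L x ≠ 0) →
      variance L P ≠ 0) :
    klDiv P (Measure.pi fun i => P.map fun v => v i) ≠ ∞ := by
  classical
  set m : ι → Measure Phasor := fun i => P.map fun v => v i
  have hm : ∀ i, IsGaussian (m i) := fun i =>
    isGaussian_map (ContinuousLinearMap.proj (R := ℝ) (φ := fun _ : ι => Phasor) i)
  have hmi : ∀ i, Measurable fun v : ι → Phasor => v i := measurable_pi_apply
  have hev : ∀ i, MeasurePreserving (fun v : ι → Phasor => v i) (Measure.pi m) (m i) :=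
    measurePreserving_eval m
  have hind : iIndepFun (fun i (v : ι → Phasor) => v i) (Measure.pi m) :=
    iIndepFun_pi (X := fun _ => id) fun i => aemeasurable_id
  have hgauss : ∀ i, HasGaussianLaw (fun v : ι → Phasor => v i) (Measure.pi m) := fun i =>
    ⟨by rw [(hev i).map_eq]; exact hm i⟩
  have hpi : IsGaussian (Measure.pi m) := by
    have := (hind.hasGaussianLaw hgauss).isGaussian_map
    simpa using this
  refine klDiv_ne_top_of_isGaussian (Submodule.pi Set.univ S) hS ?_ hmean ?_ hvar fun L hL => ?_
  · have : ∀ᵐ v ∂Measure.pi m, ∀ i, v i ∈ S i := by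
      refine ae_all_iff.2 fun i => (hev i).quasiMeasurePreserving.ae ?_
      have hcl : MeasurableSet {x | x ∈ S i} := (S i).closed_of_finiteDimensional.measurableSet
      rw [ae_map_iff (hmi i).aemeasurable hcl]
      filter_upwards [hS] with v hv using hv i trivial
    filter_upwards [this] with v hv i _ using hv i
  · ext1 i
    have hid : Integrable (fun v : ι → Phasor => v) (Measure.pi m) := IsGaussian.integrable_fun_id
    have hid' : Integrable (fun v : ι → Phasor => v) P := IsGaussian.integrable_fun_id
    have h1 := (ContinuousLinearMap.proj (R := ℝ) (φ := fun _ : ι => Phasor) i).integral_comp_comm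
      hid
    have h2 := (ContinuousLinearMap.proj (R := ℝ) (φ := fun _ : ι => Phasor) i).integral_comp_comm
      hid'
    rw [hmean] at h2
    simp only [ContinuousLinearMap.proj_apply] at h1 h2
    rw [← h1, ← integral_map (φ := fun v : ι → Phasor => v i) (f := fun x => x)
      (hmi i).aemeasurable (by fun_prop), (hev i).map_eq,
      integral_map (hmi i).aemeasurable (by fun_prop), h2]
  · refine variance_pi_ne_zero hind (fun i => (hgauss i).memLp_two) S (fun i L hL => ?_) L hL
    obtain ⟨x, hx, hLx⟩ := hL
    have h := hvar (L.comp (ContinuousLinearMap.proj i)) ⟨Pi.single i x, ?_, by simpa using hLx⟩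
    · have h1 := variance_map (X := L) (μ := Measure.pi m) (Y := fun v => v i) (by fun_prop)
        (hmi i).aemeasurable
      rw [(hev i).map_eq, variance_map (by fun_prop) (hmi i).aemeasurable] at h1
      exact fun h0 => h (h1.trans h0)
    · intro k _
      by_cases hk : k = i
      · subst hk
        simpa using hx
      · simp [Pi.single_eq_of_ne hk]

end Product

/-! ### Voltages as a linear function of the injected currents -/

section Grid

variable {ι : Type*}

/-- The voltage profiles that respect the kinds of the buses. -/
noncomputable def RadialGrid.profiles (N : RadialGrid ι) : Submodule ℝ (ι → Phasor) :=
  Submodule.pi Set.univ fun i => (N.carrier (some i)).restrictScalars ℝ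

theorem RadialGrid.mem_profiles {N : RadialGrid ι} {v : ι → Phasor} :
    v ∈ N.profiles ↔ ∀ i, v i ∈ N.carrier (some i) := by
  simp [RadialGrid.profiles, Submodule.mem_pi]

theorem RadialGrid.elim_mem_carrier {N : RadialGrid ι} {v : ι → Phasor}
    (hv : v ∈ N.profiles) (b : Option ι) :
    (b.elim 0 v : Phasor) ∈ N.carrier b := by
  cases b with
  | none => exact zero_mem _
  | some i => exact RadialGrid.mem_profiles.1 hv i

variable [Fintype ι] (N : RadialGrid ι)

theorem RadialGrid.injection_add (v w : Option ι → Phasor) (i : ι) :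
    N.injection (v + w) i = N.injection v i + N.injection w i := by
  simp only [RadialGrid.injection, Pi.add_apply, add_sub_add_comm, Matrix.mulVec_add,
    Finset.sum_add_distrib]
  abel

theorem RadialGrid.injection_smul (c : ℂ) (v : Option ι → Phasor) (i : ι) :
    N.injection (c • v) i = c • N.injection v i := by
  simp only [RadialGrid.injection, Pi.smul_apply, ← smul_sub, Matrix.mulVec_smul,
    ← Finset.smul_sum, ← smul_add]

/-- The injected currents as a linear function of the voltages at the non-slack buses, the voltage
at the substation being zero. -/
noncomputable def RadialGrid.nodalMap : (ι → Phasor) →ₗ[ℂ] (ι → Phasor) where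
  toFun v i := N.injection (fun b => b.elim 0 v) i
  map_add' v w := by
    ext1 i
    rw [Pi.add_apply, ← N.injection_add]
    congr 1
    ext1 b
    cases b <;> simp
  map_smul' c v := by
    ext1 i
    rw [Pi.smul_apply, RingHom.id_apply, ← N.injection_smul]
    congr 1
    ext1 b
    cases b <;> simp

variable {N}

theorem RadialGrid.nodalMap_mem {v : ι → Phasor} (hv : v ∈ N.profiles) :
    N.nodalMap v ∈ N.profiles := by
  classical
  have h := RadialGrid.elim_mem_carrier hv
  refine RadialGrid.mem_profiles.2 fun i => add_mem ?_ (sum_mem fun k hk => ?_)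
  · exact N.admittance_mem i _ (sub_mem (N.carrier_le i (h (some i))) (h (N.parent i)))
  · have hki : N.parent k = some i := (Finset.mem_filter.1 hk).2
    have hle := N.carrier_le k
    have hmem := N.admittance_mem k
    rw [hki] at hle hmem
    exact hle (hmem _ (sub_mem (h (some i)) (hle (h (some k)))))

/-- If no current is injected, then no current
flows in any branch, as is seen by going from the leaves to the root, and hence all voltages vanish,
as is seen by going from the root to the leaves. -/
theorem RadialGrid.eq_zero_of_nodalMap_eq_zero {v : ι → Phasor} (hv : v ∈ N.profiles)
    (h0 : N.nodalMap v = 0) : v = 0 := by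
  classical
  obtain ⟨d, hd⟩ := isRadial_iff_exists_depth.1 N.radial
  set u : Option ι → Phasor := fun b => b.elim 0 v
  have hflow : ∀ i, (N.admittance i).mulVec (u (some i) - u (N.parent i)) = 0 := by
    by_contra! hne
    -- among the branches that carry current, take one whose lower end is deepest
    have hne' : (Finset.univ.filter fun i =>
        (N.admittance i).mulVec (u (some i) - u (N.parent i)) ≠ 0).Nonempty := by
      obtain ⟨i, hi⟩ := hne
      exact ⟨i, by simpa using hi⟩
    obtain ⟨i, hi, hmax⟩ := Finset.exists_max_image _ d hne'
    refine (Finset.mem_filter.1 hi).2 ?_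
    have hi0 : N.injection u i = 0 := congrFun h0 i
    rw [RadialGrid.injection, Finset.sum_eq_zero, add_zero] at hi0
    · exact hi0
    · intro k hk
      have hki : N.parent k = some i := (Finset.mem_filter.1 hk).2
      by_contra hk0
      refine (hd k i hki).not_ge (hmax k ?_)
      rw [Finset.mem_filter, hki, ← neg_sub, Matrix.mulVec_neg]
      exact ⟨Finset.mem_univ _, neg_ne_zero.2 hk0⟩
  ext1 i
  induction hn : d i using Nat.strong_induction_on generalizing i with
  | _ n ih =>
    have hpar : u (N.parent i) = 0 := by
      cases hi : N.parent i with
      | none => rfl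
      | some k => exact ih (d k) (hn ▸ hd i k hi) k rfl
    have := hflow i
    rw [hpar, sub_zero] at this
    exact N.admittance_inj i _ (RadialGrid.mem_profiles.1 hv i) this

/-- Voltages are a linear function of the injected currents. -/
theorem RadialGrid.exists_leftInverse (N : RadialGrid ι) :
    ∃ B : (ι → Phasor) →L[ℝ] (ι → Phasor), ∀ v ∈ N.profiles, B (N.nodalMap v) = v := by
  obtain ⟨g, hg⟩ := LinearMap.exists_leftInverse_of_injective
    ((N.nodalMap.restrictScalars ℝ).domRestrict N.profiles) (by
      rw [LinearMap.ker_eq_bot']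
      exact fun v hv => Subtype.ext (RadialGrid.eq_zero_of_nodalMap_eq_zero v.2 hv))
  exact ⟨LinearMap.toContinuousLinearMap (N.profiles.subtype ∘ₗ g),
    fun v hv => congrArg Subtype.val (LinearMap.congr_fun hg ⟨v, hv⟩)⟩

/-- The law of the voltages is a nondegenerate Gaussian law, being a linear image of the law of the
independent injected currents. -/
theorem klDiv_voltageLaw_pi_ne_top {Ω : Type*} [MeasurableSpace Ω] {μ : Measure Ω}
    [IsProbabilityMeasure μ] (N : RadialGrid ι) {V : Option ι → Ω → Phasor}
    {I : ι → Ω → Phasor} (hVmeas : ∀ b, AEMeasurable (V b) μ)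
    (hV_slack : ∀ᵐ ω ∂μ, V none ω = 0)
    (hV_carrier : ∀ i, ∀ᵐ ω ∂μ, V (some i) ω ∈ N.carrier (some i))
    (hnodal : ∀ i, ∀ᵐ ω ∂μ, I i ω = N.injection (fun b => V b ω) i)
    (hI_indep : iIndepFun I μ) (hI_gauss : ∀ i, HasGaussianLaw (I i) μ)
    (hI_mean : ∀ i, ∫ ω, I i ω ∂μ = 0)
    (hI_cov : ∀ i, ∀ L : Phasor →L[ℝ] ℝ,
      (∃ x ∈ N.carrier (some i), L x ≠ 0) → variance (fun ω => L (I i ω)) μ ≠ 0) :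
    klDiv (voltageLaw μ V) (Measure.pi fun i => (voltageLaw μ V).map fun v => v i) ≠ ∞ := by
  obtain ⟨B, hB⟩ := N.exists_leftInverse
  have hmeas : AEMeasurable (fun ω i => V (some i) ω) μ :=
    aemeasurable_pi_lambda _ fun i => hVmeas (some i)
  have hmem : ∀ᵐ ω ∂μ, (fun i => V (some i) ω) ∈ N.profiles := by
    filter_upwards [ae_all_iff.2 hV_carrier] with ω hω using RadialGrid.mem_profiles.2 hω
  have hIV : ∀ᵐ ω ∂μ, (fun i => I i ω) = N.nodalMap fun i => V (some i) ω := by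
    filter_upwards [hV_slack, ae_all_iff.2 hnodal] with ω h0 h1
    have hu : (fun b => V b ω) = fun b => b.elim 0 fun i => V (some i) ω := by
      ext1 b
      cases b with
      | none => exact h0
      | some k => rfl
    ext1 i
    rw [h1 i, hu]
    rfl
  have hVB : (fun ω => B fun i => I i ω) =ᵐ[μ] fun ω i => V (some i) ω := by
    filter_upwards [hmem, hIV] with ω h1 h2
    rw [h2, hB _ h1]
  have hI : HasGaussianLaw (fun ω i => I i ω) μ := hI_indep.hasGaussianLaw hI_gauss
  have hG : IsGaussian (voltageLaw μ V) := ((hI.map_fun B).congr hVB).isGaussian_map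
  refine klDiv_pi_ne_top_of_isGaussian (fun i => (N.carrier (some i)).restrictScalars ℝ)
    ?_ ?_ fun L hL => ?_
  · have hcl : MeasurableSet {v | v ∈ N.profiles} :=
      N.profiles.closed_of_finiteDimensional.measurableSet
    exact (ae_map_iff hmeas hcl).2 hmem
  · rw [voltageLaw, integral_map hmeas (by fun_prop), ← integral_congr_ae hVB,
      B.integral_comp_comm hI.integrable]
    have : ∫ ω, (fun i => I i ω) ∂μ = 0 := by
      ext1 i
      have h := (ContinuousLinearMap.proj (R := ℝ) (φ := fun _ : ι => Phasor) i).integral_comp_comm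
        hI.integrable
      simp only [ContinuousLinearMap.proj_apply, hI_mean] at h
      exact h.symm
    rw [this, map_zero]
  · rw [voltageLaw, variance_map (by fun_prop) hmeas]
    obtain ⟨x, hx, hLx⟩ := hL
    have h := variance_pi_ne_zero hI_indep (fun i => (hI_gauss i).memLp_two)
      (fun i => (N.carrier (some i)).restrictScalars ℝ) hI_cov (L.comp B)
      ⟨N.nodalMap x, RadialGrid.nodalMap_mem hx, by
        rwa [ContinuousLinearMap.comp_apply, hB x hx]⟩
    rw [variance_congr (Y := fun ω => (L.comp B) fun i => I i ω)]
    · exact h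
    · filter_upwards [hVB] with ω hω
      rw [Function.comp_apply, ← hω]
      rfl

end Grid

/-! ### Best-fitted topologies and maximum weight spanning trees -/

section BestFitted

variable {ι : Type*} [Fintype ι] {P : Measure (ι → Phasor)} {Θ : ι → Option ι}

/-- All buses that the substation feeds, except for one, can be attached to that one. -/
theorem IsRadial.exists_singleFeeder [Nonempty ι] (h : IsRadial Θ) :
    ∃ Θ' : ι → Option ι, IsRadial Θ' ∧ SingleFeeder Θ' ∧ ∀ i k, Θ i = some k → Θ' i = some k := by
  classical
  obtain ⟨d, hd⟩ := isRadial_iff_exists_depth.1 h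
  -- a bus of least depth is fed by the substation
  obtain ⟨r, -, hmin⟩ := Finset.exists_min_image Finset.univ d Finset.univ_nonempty
  have hr : Θ r = none := by
    by_contra hne
    obtain ⟨k, hk⟩ := Option.ne_none_iff_exists'.1 hne
    exact (hd r k hk).not_ge (hmin k (Finset.mem_univ k))
  refine ⟨fun i => if i = r then none else some ((Θ i).getD r), ?_,
    ⟨r, by simp, fun i hi => by simpa using hi⟩, fun i k hik => ?_⟩
  · refine isRadial_iff_exists_depth.2 ⟨fun i => if i = r then 0 else d i + 1, fun i k hik => ?_⟩
    by_cases hi : i = r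
    · simp [hi] at hik
    by_cases hk : k = r
    · simp [hi, hk]
    cases hΘ : Θ i with
    | none =>
      simp only [hi, hΘ, if_false, Option.getD_none, Option.some.injEq] at hik
      exact absurd hik.symm hk
    | some l =>
      simp only [hi, hΘ, if_false, Option.getD_some, Option.some.injEq] at hik
      subst hik
      simpa [hi, hk] using hd i l hΘ
  · have hi : i ≠ r := by
      rintro rfl
      simp [hr] at hik
    simp [hi, hik]

theorem isBestFitted_iff_maximizesInfo [IsProbabilityMeasure P]
    (hkl : klDiv P (Measure.pi fun i => P.map fun v => v i) ≠ ∞) :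
    IsBestFitted P Θ ↔ MaximizesInfo P Θ := by
  refine and_congr_right fun hΘ => forall₂_congr fun Θ' hΘ' => ?_
  obtain ⟨h1, h2⟩ := klDiv_treeModel_add_sum hkl hΘ
  obtain ⟨h1', h2'⟩ := klDiv_treeModel_add_sum hkl hΘ'
  have hsum : ∑ i, parentInfo P i (Θ i) ≠ ∞ := fun h => hkl (by rw [← h2, h, add_top])
  constructor
  · intro hle
    by_contra! hlt
    exact (ENNReal.add_lt_add_of_le_of_lt h1 hle hlt).ne (h2.trans h2'.symm)
  · intro hle
    by_contra! hlt
    have hsum' : ∑ i, parentInfo P i (Θ' i) ≠ ∞ := ne_top_of_le_ne_top hsum hle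
    exact (ENNReal.add_lt_add_of_lt_of_le hsum' hlt hle).ne (h2'.trans h2.symm)

theorem IsRadial.sum_pairInfo_branches [IsFiniteMeasure P] (h : IsRadial Θ) :
    ∑ e ∈ branches Θ, pairInfo P e = ∑ i, parentInfo P i (Θ i) := by
  rw [h.sum_branches]
  refine Finset.sum_congr rfl fun i _ => ?_
  cases Θ i <;> rfl

theorem maximizesInfo_iff_isMaxSpanningTree [Nonempty ι] [IsFiniteMeasure P] (h : IsRadial Θ)
    (hs : SingleFeeder Θ) :
    MaximizesInfo P Θ ↔ IsMaxSpanningTree (pairInfo P) (branches Θ) := by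
  constructor
  · rintro ⟨-, hmax⟩
    refine ⟨h.isSpanningTree_branches hs, fun E hE => ?_⟩
    obtain ⟨Θ', hΘ', -, -, rfl⟩ := hE.exists_isRadial (Classical.arbitrary ι)
    rw [hΘ'.sum_pairInfo_branches, h.sum_pairInfo_branches]
    exact hmax Θ' hΘ'
  · rintro ⟨-, hmax⟩
    refine ⟨h, fun Θ' hΘ' => ?_⟩
    obtain ⟨Θ₁, h₁, hs₁, hext⟩ := hΘ'.exists_singleFeeder
    calc ∑ i, parentInfo P i (Θ' i) ≤ ∑ i, parentInfo P i (Θ₁ i) := by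
          refine Finset.sum_le_sum fun i _ => ?_
          cases hi : Θ' i with
          | none => exact zero_le
          | some k => rw [hext i k hi]
      _ = ∑ e ∈ branches Θ₁, pairInfo P e := h₁.sum_pairInfo_branches.symm
      _ ≤ ∑ e ∈ branches Θ, pairInfo P e := hmax _ (h₁.isSpanningTree_branches hs₁)
      _ = ∑ i, parentInfo P i (Θ i) := h.sum_pairInfo_branches

theorem IsRadial.singleFeeder_of_isSpanningTree (h : IsRadial Θ)
    (hE : IsSpanningTree (branches Θ)) : SingleFeeder Θ :=
  h.singleFeeder_iff_card.2 (isSpanningTree_iff_connected_and_card.1 hE).2.2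

/-- If some radial topology reproduces the law `P` exactly, then so does every best-fitted one. -/
theorem IsBestFitted.treeModel_eq [IsProbabilityMeasure P]
    (hkl : klDiv P (Measure.pi fun i => P.map fun v => v i) ≠ ∞) (hΘ : IsBestFitted P Θ)
    {Θ' : ι → Option ι} (hΘ' : IsRadial Θ') (heq : treeModel P Θ' = P) : treeModel P Θ = P := by
  have := isProbabilityMeasure_treeModel
    (fun i k hik => ne_top_of_le_ne_top hkl (mutualInfo_le_klDiv_pi hik)) hΘ.1
  have h := hΘ.2 Θ' hΘ'
  rw [heq, klDiv_self, nonpos_iff_eq_zero, klDiv_eq_zero_iff] at h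
  exact h.symm

end BestFitted

end ChowLiuGrid

theorem mainTheorem1 {ι Ω : Type*} [Fintype ι] [Nonempty ι] [MeasurableSpace Ω]
    (μ : Measure Ω) [IsProbabilityMeasure μ]
    (N : ChowLiuGrid.RadialGrid ι)
    -- voltage increments `V` at all buses, current injection increments `I` at non-slack buses
    (V : Option ι → Ω → ChowLiuGrid.Phasor) (I : ι → Ω → ChowLiuGrid.Phasor)
    (hVmeas : ∀ b, AEMeasurable (V b) μ)
    -- the substation voltage is fixed, and every bus carries phasors of its kind only
    (hV_slack : ∀ᵐ ω ∂μ, V none ω = 0)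
    (hV_carrier : ∀ i, ∀ᵐ ω ∂μ, V (some i) ω ∈ N.carrier (some i))
    -- nodal admittance equation
    (hnodal : ∀ i, ∀ᵐ ω ∂μ, I i ω = N.injection (fun b => V b ω) i)
    -- the current injection increments are independent, Gaussian, of mean zero and of
    -- nonsingular covariance (on the phasors that the bus carries)
    (hI_indep : iIndepFun I μ)
    (hI_gauss : ∀ i, HasGaussianLaw (I i) μ)
    (hI_mean : ∀ i, ∫ ω, I i ω ∂μ = 0)
    (hI_cov : ∀ i, ∀ L : ChowLiuGrid.Phasor →L[ℝ] ℝ,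
      (∃ x ∈ N.carrier (some i), L x ≠ 0) → variance (fun ω => L (I i ω)) μ ≠ 0) :
    -- the quantities involved are finite, the tree-structured laws are probability laws
    (∀ i k, i ≠ k → ChowLiuGrid.mutualInfo (ChowLiuGrid.voltageLaw μ V) i k ≠ ∞) ∧
    (∀ Θ, ChowLiuGrid.IsRadial Θ →
      IsProbabilityMeasure (ChowLiuGrid.treeModel (ChowLiuGrid.voltageLaw μ V) Θ) ∧
      klDiv (ChowLiuGrid.voltageLaw μ V)
        (ChowLiuGrid.treeModel (ChowLiuGrid.voltageLaw μ V) Θ) ≠ ∞) ∧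
    -- best-fitted topologies are the maximizers of the sum of mutual informations, and those with
    -- one feeder are the maximum weight spanning trees
    (∀ Θ, ChowLiuGrid.IsBestFitted (ChowLiuGrid.voltageLaw μ V) Θ ↔
      ChowLiuGrid.MaximizesInfo (ChowLiuGrid.voltageLaw μ V) Θ) ∧
    (∀ Θ, ChowLiuGrid.IsRadial Θ → ChowLiuGrid.SingleFeeder Θ →
      (ChowLiuGrid.IsBestFitted (ChowLiuGrid.voltageLaw μ V) Θ ↔
        ChowLiuGrid.IsMaxSpanningTree (ChowLiuGrid.pairInfo (ChowLiuGrid.voltageLaw μ V))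
          (ChowLiuGrid.branches Θ))) ∧
    -- the Chow-Liu algorithm, however ties are broken
    (∀ T : List (Sym2 ι),
      ChowLiuGrid.IsSortedPairList (ChowLiuGrid.pairInfo (ChowLiuGrid.voltageLaw μ V)) T →
      -- returns a maximum weight spanning tree,
      ChowLiuGrid.IsMaxSpanningTree (ChowLiuGrid.pairInfo (ChowLiuGrid.voltageLaw μ V))
        (ChowLiuGrid.chowLiu T) ∧
      -- which, fed from the substation through any bus, is a best-fitted topology,
      (∀ r : ι, ∃ Θ, ChowLiuGrid.IsRadial Θ ∧ Θ r = none ∧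
        ChowLiuGrid.branches Θ = ChowLiuGrid.chowLiu T) ∧
      (∀ Θ, ChowLiuGrid.IsRadial Θ → ChowLiuGrid.branches Θ = ChowLiuGrid.chowLiu T →
        ChowLiuGrid.IsBestFitted (ChowLiuGrid.voltageLaw μ V) Θ ∧
        -- which reproduces the true law if the grid's own tree does so,
        (ChowLiuGrid.treeModel (ChowLiuGrid.voltageLaw μ V) N.parent =
            ChowLiuGrid.voltageLaw μ V →
          ChowLiuGrid.treeModel (ChowLiuGrid.voltageLaw μ V) Θ =
            ChowLiuGrid.voltageLaw μ V)) ∧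
      -- and which is the grid itself if the grid is the only best-fitted topology up to the
      -- choice of the feeding bus
      (ChowLiuGrid.SingleFeeder N.parent →
        (∀ Θ, ChowLiuGrid.SingleFeeder Θ →
          ChowLiuGrid.IsBestFitted (ChowLiuGrid.voltageLaw μ V) Θ →
          ChowLiuGrid.branches Θ = ChowLiuGrid.branches N.parent) →
        ChowLiuGrid.chowLiu T = ChowLiuGrid.branches N.parent)) := by
  classical
  have hprob : IsProbabilityMeasure (ChowLiuGrid.voltageLaw μ V) :=
    Measure.isProbabilityMeasure_map (aemeasurable_pi_lambda _ fun i => hVmeas (some i))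
  have hkl := ChowLiuGrid.klDiv_voltageLaw_pi_ne_top N hVmeas hV_slack hV_carrier hnodal hI_indep
    hI_gauss hI_mean hI_cov
  have hfin : ∀ i k, i ≠ k → ChowLiuGrid.mutualInfo (ChowLiuGrid.voltageLaw μ V) i k ≠ ∞ :=
    fun i k hik => ne_top_of_le_ne_top hkl (ChowLiuGrid.mutualInfo_le_klDiv_pi hik)
  have hbest : ∀ Θ, ChowLiuGrid.IsRadial Θ → ChowLiuGrid.SingleFeeder Θ →
      (ChowLiuGrid.IsBestFitted (ChowLiuGrid.voltageLaw μ V) Θ ↔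
        ChowLiuGrid.IsMaxSpanningTree (ChowLiuGrid.pairInfo (ChowLiuGrid.voltageLaw μ V))
          (ChowLiuGrid.branches Θ)) := fun Θ h hs =>
    (ChowLiuGrid.isBestFitted_iff_maximizesInfo hkl).trans
      (ChowLiuGrid.maximizesInfo_iff_isMaxSpanningTree h hs)
  refine ⟨hfin, fun Θ hΘ => ⟨ChowLiuGrid.isProbabilityMeasure_treeModel hfin hΘ,
    (ChowLiuGrid.klDiv_treeModel_add_sum hkl hΘ).1⟩,
    fun Θ => ChowLiuGrid.isBestFitted_iff_maximizesInfo hkl, hbest, fun T hT => ?_⟩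
  have hmst := ChowLiuGrid.isMaxSpanningTree_chowLiu hT
  refine ⟨hmst, fun r => ?_, fun Θ hΘ hbr => ?_, fun _ huniq => ?_⟩
  · obtain ⟨Θ, hΘ, -, hr, hbr⟩ := hmst.1.exists_isRadial r
    exact ⟨Θ, hΘ, hr, hbr⟩
  · have hs := hΘ.singleFeeder_of_isSpanningTree (hbr ▸ hmst.1)
    have hbf := (hbest Θ hΘ hs).2 (hbr ▸ hmst)
    exact ⟨hbf, hbf.treeModel_eq hkl N.radial⟩
  · obtain ⟨Θ, hΘ, hs, -, hbr⟩ := hmst.1.exists_isRadial (Classical.arbitrary ι)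
    rw [← hbr]
    exact huniq Θ hs ((hbest Θ hΘ hs).2 (hbr ▸ hmst))
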